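/- There is a universal constant $\alpha>0$ such that the following holds. Let $\mathcal X$ be a measurable space, $\mathcal D$ an arbitrary probability distribution over $\mathcal X$, $c:\mathcal X\to\{-1,1\}$ a measurable concept, and $\mathcal H\subseteq \mathcal X\to\{-1,1\}$ a set of measurable hypotheses of finite VC-dimension $d$ (the largest cardinality of a finite set of points on which every $\pm1$-labelling is realized by some $h\in\mathcal H$). Assume that $\mathcal H$ is measurable as a class: for every $n$ and every $v\in\{-1,1\}^n$, the set $\{x\in\mathcal X^n : \exists h\in\mathcal H\ \forall i\ h(x_i)=v_i\}$ is measurable with respect to the completion of $\mathcal D^n$ (this is automatic if $\mathcal H$ is countable, or if $\mathcal X$ is countable and all its subsets are measurable). Let $\Delta(\mathcal H)$ be the set of all finite convex combinations $f(x)=\sum_{i=1}^t\alpha_i h_i(x)$ with $h_i\in\mathcal H$, $\alpha_i>0$ and $\sum_i\alpha_i=1$. Let $\gamma>0$, $0<\delta<1$, and let $m$ be an integer with $$m\ \ge\ \alpha\bigl(d\gamma^{-2}+\ln(1/\delta)\bigr).$$ Then with probability at least $1-\delta$ over a sample $S=(x_1,\dots,x_m)\sim\mathcal D^m$ (that is,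 for all $S$ in some measurable set of $\mathcal D^m$-probability at least $1-\delta$), every voting classifier $g(x)=\operatorname{sign}(f(x))$ with $f\in\Delta(\mathcal H)$ and margins $c(x_i)f(x_i)\ge\gamma$ for all $i=1,\dots,m$ satisfies $$\mathcal L_{\mathcal D}(g)=\Pr_{x\sim\mathcal D}\bigl[g(x)\ne c(x)\bigr]\ \le\ \tfrac1{200},$$ where $\operatorname{sign}(0)=0$, so that a point with $f(x)=0$ always counts as an error. -/

import Mathlib

open MeasureTheory

namespace Voting

/-- The labels `-1` and `1` are the units of `ℤ`; `label y` is the label as a real number. -/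
def label (y : ℤˣ) : ℝ := ((y : ℤ) : ℝ)

/-- A hypothesis set `H ⊆ X → {-1, 1}` shatters the finite set `s` if every classification of `s` is
realized by some hypothesis in `H`. -/
def Shatters {X : Type*} (H : Set (X → ℤˣ)) (s : Finset X) : Prop :=
  ∀ σ : X → ℤˣ, ∃ h ∈ H, ∀ x ∈ s, h x = σ x

/-- The VC-dimension: the largest cardinality of a shattered finite set (`⊤` if unbounded). -/
noncomputable def vcDim {X : Type*} (H : Set (X → ℤˣ)) : ℕ∞ :=
  ⨆ (s : Finset X) (_ : Shatters H s), (s.card : ℕ∞)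

/-- `Δ(H)`: all functions `f(x) = ∑ i, w i * h i x` with `h i ∈ H`, `w i > 0` and `∑ i, w i = 1`. -/
def convexCombinations {X : Type*} (H : Set (X → ℤˣ)) : Set (X → ℝ) :=
  {f | ∃ (t : ℕ) (w : Fin t → ℝ) (h : Fin t → X → ℤˣ),
    (∀ i, 0 < w i) ∧ ∑ i, w i = 1 ∧ (∀ i, h i ∈ H) ∧ ∀ x, f x = ∑ i, w i * label (h i x)}

/-- The voting classifier `sign(f)`. At a tie `f x = 0` its value is `0`, which is neither of the two
labels, so that a tie always counts as a misprediction. -/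
noncomputable def votingClassifier {X : Type*} (f : X → ℝ) : X → ℝ := fun x => Real.sign (f x)

/-- The generalization error `Pr_{x ∼ D}[g(x) ≠ c(x)]`. -/
noncomputable def generalizationError {X : Type*} [MeasurableSpace X] (D : Measure X)
    (c : X → ℤˣ) (g : X → ℝ) : ℝ :=
  D.real {x | g x ≠ label (c x)}

/-- The law `D^m` of `m` independent samples from `D`. -/
noncomputable def sampleLaw {X : Type*} [MeasurableSpace X] (D : Measure X) (m : ℕ) :
    Measure (Fin m → X) :=
  Measure.pi fun _ => D

/-- Measurability of `H` as a class: each hypothesis is measurable, and for every labelling pattern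
`v ∈ {-1, 1}^n` the event that a random sample of size `n` can be labelled by `v` with a hypothesis
of `H` is an event, up to null sets of `D^n`. -/
structure MeasurableClass {X : Type*} [MeasurableSpace X] (D : Measure X)
    (H : Set (X → ℤˣ)) : Prop where
  measurable : ∀ h ∈ H, Measurable h
  pattern : ∀ (n : ℕ) (v : Fin n → ℤˣ),
    NullMeasurableSet {x : Fin n → X | ∃ h ∈ H, ∀ i, h (x i) = v i} (sampleLaw D n)

end Voting

/-! The argument combines a ghost sample with Rademacher averages. If a voting classifier errs with
probability above `1/200`, an independent second sample contains at least `m/400` of its errors with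
probability at least `1/2` (`half_le_measure_count`). So it suffices to bound the double-sample
event `doubleBad`. The law of the double sample is invariant under swapping the two copies of any
index, so one may fix all `2m` points and randomize only the swaps (`measure_doubleBad_le`).

For fixed points, every bad swap makes a signed sum of ramp differences at least `m/400`. The
supremum of these sums has mean at most `m/800`: contraction removes the ramp at the price `1/γ`,
linearity reduces convex combinations to `H`, and chaining bounds the Rademacher average of a VC
class by `25 √(d m)` (`rmean_iSup_signVec_le`). Chaining avoids the logarithmic factor that a single
union bound over all patterns would cost. Bounded differences (`rmean_exp_le`) then make bad swaps
exponentially rare in `m`.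

The cases `d = 0` and `γ > 1` are degenerate and handled directly. -/

namespace Voting

/-! ### Averages over random signs: contraction, Massart, bounded differences. -/

/-- The sign `1` or `-1` encoded by a Boolean. -/
def sgn (b : Bool) : ℝ := if b then 1 else -1

/-- The mean of a function of independent uniform signs. -/
noncomputable def rmean {ι : Type*} [Fintype ι] [DecidableEq ι] (F : (ι → Bool) → ℝ) : ℝ :=
  (∑ σ, F σ) / 2 ^ Fintype.card ι

section rmean

variable {ι : Type*} [Fintype ι] [DecidableEq ι]

theorem rmean_mono {F G : (ι → Bool) → ℝ} (h : ∀ σ, F σ ≤ G σ) : rmean F ≤ rmean G := by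
  unfold rmean
  gcongr with σ
  exact h σ

theorem rmean_add (F G : (ι → Bool) → ℝ) :
    rmean (fun σ => F σ + G σ) = rmean F + rmean G := by
  simp [rmean, Finset.sum_add_distrib, add_div]

theorem rmean_const_mul (c : ℝ) (F : (ι → Bool) → ℝ) :
    rmean (fun σ => c * F σ) = c * rmean F := by
  simp [rmean, ← Finset.mul_sum, mul_div_assoc]

theorem exp_rmean_le (F : (ι → Bool) → ℝ) :
    Real.exp (rmean F) ≤ rmean fun σ => Real.exp (F σ) := by
  have h := convexOn_exp.map_sum_le (t := (Finset.univ : Finset (ι → Bool)))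
    (w := fun _ => 1 / 2 ^ Fintype.card ι) (p := F) (by intros; positivity)
    (by simp) (by simp)
  simp only [smul_eq_mul, ← Finset.mul_sum] at h
  simpa [rmean, div_eq_inv_mul] using h

/-- Flipping coordinate `i` permutes the cube, so overwriting it with both values covers each sign
vector twice. -/
theorem sum_update_add_update (F : (ι → Bool) → ℝ) (i : ι) :
    ∑ σ, (F (Function.update σ i true) + F (Function.update σ i false)) = 2 * ∑ σ, F σ := by
  have hinv : Function.Involutive fun σ : ι → Bool => Function.update σ i (!σ i) := by
    intro σ
    simp
  have h1 : ∑ σ, F (Function.update σ i (!σ i)) = ∑ σ, F σ :=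
    Equiv.sum_comp hinv.toPerm F
  rw [two_mul]
  nth_rewrite 2 [← h1]
  rw [← Finset.sum_add_distrib]
  refine Finset.sum_congr rfl fun σ _ => ?_
  have h2 : F σ = F (Function.update σ i (σ i)) := by simp
  rw [h2]
  cases σ i <;> simp [add_comm]

theorem rmean_le_of_update {F G : (ι → Bool) → ℝ} (i : ι)
    (h : ∀ σ, F (Function.update σ i true) + F (Function.update σ i false) ≤
      G (Function.update σ i true) + G (Function.update σ i false)) : rmean F ≤ rmean G := by
  unfold rmean
  gcongr ?_ / _
  have := Finset.sum_le_sum fun σ (_ : σ ∈ Finset.univ) => h σ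
  rw [sum_update_add_update, sum_update_add_update] at this
  linarith

theorem le_iSup_fin {J : Type*} [Finite J] (f : J → ℝ) (j : J) : f j ≤ ⨆ j, f j :=
  le_ciSup (Set.finite_range f).bddAbove j

/-- The one-coordinate case of contraction. Maximizers `j`, `k` on the left contribute `u j - u k ≤
|w j - w k|`, and the same pair, in one of its two orders, competes on the right. -/
theorem iSup_add_iSup_sub_le {J : Type*} [Finite J] [Nonempty J] (A u w : J → ℝ)
    (h : ∀ j k, |u j - u k| ≤ |w j - w k|) :
    (⨆ j, (A j + u j)) + (⨆ j, (A j - u j)) ≤ (⨆ j, (A j + w j)) + ⨆ j, (A j - w j) := by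
  obtain ⟨j, hj⟩ := exists_eq_ciSup_of_finite (f := fun j => A j + u j)
  obtain ⟨k, hk⟩ := exists_eq_ciSup_of_finite (f := fun j => A j - u j)
  rw [← hj, ← hk]
  have h1 := (le_abs_self _).trans (h j k)
  have a1 := le_iSup_fin (fun j => A j + w j) j
  have a2 := le_iSup_fin (fun j => A j - w j) k
  have a3 := le_iSup_fin (fun j => A j + w j) k
  have a4 := le_iSup_fin (fun j => A j - w j) j
  rcases abs_cases (w j - w k) with ⟨h2, _⟩ | ⟨h2, _⟩ <;> rw [h2] at h1 <;> linarith

/-- The contraction principle for Rademacher averages. -/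
theorem rmean_iSup_contraction {J : Type*} [Finite J] [Nonempty J] (u w : J → ι → ℝ)
    (h : ∀ i j k, |u j i - u k i| ≤ |w j i - w k i|) :
    (rmean fun σ => ⨆ j, ∑ i, sgn (σ i) * u j i) ≤
      rmean fun σ => ⨆ j, ∑ i, sgn (σ i) * w j i := by
  -- Replace `u` by `w` one coordinate at a time, the other signs being frozen.
  suffices H : ∀ s : Finset ι, (rmean fun σ => ⨆ j, ∑ i, sgn (σ i) * u j i) ≤
      rmean fun σ => ⨆ j, ∑ i, sgn (σ i) * (if i ∈ s then w j i else u j i) by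
    simpa using H Finset.univ
  intro s
  induction s using Finset.induction_on with
  | empty => simp
  | insert i s hi ih =>
    refine ih.trans (rmean_le_of_update i fun σ => ?_)
    have key : ∀ (b : Bool) (j : J) (t : Finset ι),
        ∑ l, sgn (Function.update σ i b l) * (if l ∈ t then w j l else u j l) =
        (∑ l ∈ Finset.univ.erase i, sgn (σ l) * (if l ∈ t then w j l else u j l)) +
          sgn b * (if i ∈ t then w j i else u j i) := by
      intro b j t
      rw [← Finset.sum_erase_add _ _ (Finset.mem_univ i), Function.update_self]
      congr 1
      refine Finset.sum_congr rfl fun l hl => ?_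
      rw [Function.update_of_ne (Finset.ne_of_mem_erase hl)]
    have key2 : ∀ j, (∑ l ∈ Finset.univ.erase i,
        sgn (σ l) * (if l ∈ insert i s then w j l else u j l)) =
        ∑ l ∈ Finset.univ.erase i, sgn (σ l) * (if l ∈ s then w j l else u j l) := by
      intro j
      refine Finset.sum_congr rfl fun l hl => ?_
      simp [Finset.mem_insert, Finset.ne_of_mem_erase hl]
    simp only [key, key2, if_neg hi, Finset.mem_insert_self, if_true]
    have := iSup_add_iSup_sub_le
      (fun j => ∑ l ∈ Finset.univ.erase i, sgn (σ l) * (if l ∈ s then w j l else u j l))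
      (fun j => u j i) (fun j => w j i) (h i)
    simpa [sgn, sub_eq_add_neg] using this

theorem rmean_exp_sum (v : ι → ℝ) :
    (rmean fun σ => Real.exp (∑ i, sgn (σ i) * v i)) = ∏ i, Real.cosh (v i) := by
  have : ∑ σ : ι → Bool, ∏ i, Real.exp (sgn (σ i) * v i) =
      ∏ i, ∑ b : Bool, Real.exp (sgn b * v i) := by
    rw [Finset.prod_univ_sum, Fintype.piFinset_univ]
  simp only [rmean, Real.exp_sum, this]
  simp [sgn, Real.cosh_eq, Finset.prod_div_distrib]

theorem rmean_exp_sum_le (v : ι → ℝ) :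
    (rmean fun σ => Real.exp (∑ i, sgn (σ i) * v i)) ≤ Real.exp ((∑ i, v i ^ 2) / 2) := by
  rw [rmean_exp_sum, Finset.sum_div, Real.exp_sum]
  exact Finset.prod_le_prod (fun i _ => (Real.cosh_pos _).le)
    fun i _ => Real.cosh_le_exp_half_sq (v i)

/-- Massart's maximal inequality for finitely many vectors. -/
theorem rmean_iSup_le {J : Type*} [Fintype J] [Nonempty J] (v : J → ι → ℝ) {K l : ℝ}
    (hl : 0 < l) (hv : ∀ j, ∑ i, v j i ^ 2 ≤ K) :
    (rmean fun σ => ⨆ j, ∑ i, sgn (σ i) * v j i) ≤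
      Real.log (Fintype.card J) / l + l * K / 2 := by
  -- Jensen, then the exponential of a maximum is at most the sum of exponentials. The parameter `l`
  -- stays free because chaining tunes it at each scale.
  have h1 : Real.exp (l * rmean fun σ => ⨆ j, ∑ i, sgn (σ i) * v j i) ≤
      Fintype.card J * Real.exp (l ^ 2 * K / 2) := by
    rw [← rmean_const_mul]
    refine (exp_rmean_le _).trans ?_
    calc _ ≤ rmean fun σ => ∑ j, Real.exp (∑ i, sgn (σ i) * (l * v j i)) := by
          refine rmean_mono fun σ => ?_
          obtain ⟨j, hj⟩ := exists_eq_ciSup_of_finite (f := fun j => ∑ i, sgn (σ i) * v j i)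
          rw [← hj]
          refine le_trans (le_of_eq ?_) (Finset.single_le_sum
            (f := fun j => Real.exp (∑ i, sgn (σ i) * (l * v j i)))
            (fun _ _ => (Real.exp_pos _).le) (Finset.mem_univ j))
          simp only [Finset.mul_sum]
          congr 1
          exact Finset.sum_congr rfl fun i _ => by ring
      _ = ∑ j, rmean fun σ => Real.exp (∑ i, sgn (σ i) * (l * v j i)) := by
          simp only [rmean, ← Finset.sum_div]
          rw [Finset.sum_comm]
      _ ≤ ∑ _j : J, Real.exp (l ^ 2 * K / 2) := by
          refine Finset.sum_le_sum fun j _ => (rmean_exp_sum_le _).trans ?_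
          simp only [mul_pow, ← Finset.mul_sum]
          gcongr
          exact hv j
      _ = _ := by simp
  have hc : (0 : ℝ) < Fintype.card J := by exact_mod_cast Fintype.card_pos
  have h2 := Real.log_le_log (Real.exp_pos _) h1
  rw [Real.log_exp, Real.log_mul hc.ne' (Real.exp_pos _).ne', Real.log_exp] at h2
  have h3 : Real.log (Fintype.card J) / l + l * K / 2 =
      (Real.log (Fintype.card J) + l ^ 2 * K / 2) / l := by
    field_simp
  rw [h3, le_div_iff₀ hl]
  linarith

end rmean

/-- The bounded difference inequality on the discrete cube. -/
theorem rmean_exp_le (n : ℕ) (F : (Fin n → Bool) → ℝ) (b : ℝ)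
    (hF : ∀ σ i y, |F (Function.update σ i y) - F σ| ≤ 2 * b) :
    (rmean fun σ => Real.exp (F σ)) ≤ Real.exp (rmean F + n * b ^ 2 / 2) := by
  induction n with
  | zero => simp [rmean]
  | succ n ih =>
    have split : ∀ G : (Fin (n + 1) → Bool) → ℝ, rmean G =
        rmean fun τ : Fin n → Bool =>
          (G (Fin.cons true τ) + G (Fin.cons false τ)) / 2 := by
      intro G
      unfold rmean
      rw [← (Fin.consEquiv fun _ => Bool).sum_comp, Fintype.sum_prod_type]
      simp only [Fintype.sum_bool, ← Finset.sum_add_distrib, Fintype.card_fin, ← Finset.sum_div]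
      rw [pow_succ, div_div, mul_comm]
      rfl
    -- `G` averages out the first sign. The two values of `F` are `G ± e` with `|e| ≤ |b|`, so this
    -- sign costs a factor `cosh e ≤ exp (b ^ 2 / 2)`.
    set G : (Fin n → Bool) → ℝ := fun τ => (F (Fin.cons true τ) + F (Fin.cons false τ)) / 2
      with hG
    have hGb : ∀ σ i y, |G (Function.update σ i y) - G σ| ≤ 2 * b := by
      intro σ i y
      have h1 := hF (Fin.cons true σ) i.succ y
      have h2 := hF (Fin.cons false σ) i.succ y
      rw [← Fin.cons_update] at h1 h2
      simp only [hG]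
      rw [abs_le] at *
      constructor <;> linarith [h1.1, h1.2, h2.1, h2.2]
    rw [split, split F]
    calc _ ≤ rmean fun τ => Real.exp (b ^ 2 / 2) * Real.exp (G τ) := by
          refine rmean_mono fun τ => ?_
          set e := (F (Fin.cons true τ) - F (Fin.cons false τ)) / 2 with he
          have h1 : F (Fin.cons true τ) = G τ + e := by simp only [hG, he]; ring
          have h2 : F (Fin.cons false τ) = G τ + -e := by simp only [hG, he]; ring
          have h3 : |e| ≤ |b| := by
            have := hF (Fin.cons false τ) 0 true
            rw [Fin.update_cons_zero] at this
            rw [he, abs_div, abs_two]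
            linarith [le_abs_self b]
          have h4 : e ^ 2 ≤ b ^ 2 := sq_le_sq.mpr h3
          rw [h1, h2, Real.exp_add, Real.exp_add, ← mul_add, mul_div_assoc, ← Real.cosh_eq,
            mul_comm]
          gcongr
          exact (Real.cosh_le_exp_half_sq e).trans (by gcongr)
      _ = Real.exp (b ^ 2 / 2) * rmean fun τ => Real.exp (G τ) := rmean_const_mul _ _
      _ ≤ Real.exp (b ^ 2 / 2) * Real.exp (rmean G + n * b ^ 2 / 2) := by
          gcongr
          exact ih G hGb
      _ = _ := by
          rw [← Real.exp_add]
          push_cast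
          congr 1
          ring

/-! ### Packing numbers and chaining for set families of bounded VC-dimension. -/

section Packing

/-- The trace of a set family along a map of the ground sets. -/
def comapFamily {α β : Type*} [DecidableEq α] [Fintype β] [DecidableEq β]
    (g : β → α) (T : Finset (Finset α)) : Finset (Finset β) :=
  T.image fun A => Finset.univ.filter fun b => g b ∈ A

/-- Points identified by `g` cannot be separated, so `g` is injective on a shattered set and its
image is shattered by `T`. -/
theorem vcDim_comapFamily_le {α β : Type*} [DecidableEq α] [Fintype β] [DecidableEq β]
    (g : β → α) (T : Finset (Finset α)) : (comapFamily g T).vcDim ≤ T.vcDim := by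
  refine Finset.sup_le fun s hs => ?_
  rw [Finset.mem_shatterer] at hs
  have hinj : Set.InjOn g s := by
    intro a ha b hb hab
    by_contra hne
    obtain ⟨u, hu, h⟩ := hs (Finset.singleton_subset_iff.mpr ha)
    obtain ⟨A, -, rfl⟩ := Finset.mem_image.mp hu
    have h1 : a ∈ s ∩ Finset.univ.filter fun b => g b ∈ A := by simp [h]
    have h2 : b ∉ s ∩ Finset.univ.filter fun b => g b ∈ A := by
      simpa [h] using fun h' => hne h'.symm
    simp only [Finset.mem_inter, Finset.mem_filter, Finset.mem_univ, true_and] at h1 h2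
    exact h2 ⟨hb, hab ▸ h1.2⟩
  rw [← Finset.card_image_of_injOn hinj]
  refine Finset.Shatters.card_le_vcDim fun t ht => ?_
  obtain ⟨u, hu, h⟩ := hs (Finset.filter_subset (fun b => g b ∈ t) s)
  obtain ⟨A, hA, rfl⟩ := Finset.mem_image.mp hu
  refine ⟨A, hA, ?_⟩
  ext a
  simp only [Finset.mem_inter, Finset.mem_image]
  have key : ∀ b ∈ s, (g b ∈ A ↔ g b ∈ t) := by
    intro b hb
    have := Finset.ext_iff.mp h b
    simpa [hb] using this
  constructor
  · rintro ⟨⟨b, hb, rfl⟩, hA'⟩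
    exact (key b hb).mp hA'
  · intro ha
    obtain ⟨b, hb, rfl⟩ := Finset.mem_image.mp (ht ha)
    exact ⟨⟨b, hb, rfl⟩, (key b hb).mpr ha⟩

/-- Sauer–Shelah, with the binomial sum weighted by `x ^ k ≥ x ^ d` and completed to `(1 + x) ^ n`.
-/
theorem card_le_of_vcDim_le {β : Type*} [Fintype β] [DecidableEq β] (T : Finset (Finset β))
    {d : ℕ} (hd : T.vcDim ≤ d) {x : ℝ} (hx : 0 < x) (hx1 : x ≤ 1) :
    (T.card : ℝ) ≤ (1 / x) ^ d * Real.exp (Fintype.card β * x) := by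
  set n := Fintype.card β
  have h1 : (T.card : ℝ) ≤ ∑ k ∈ Finset.Iic d, (n.choose k : ℝ) := by
    have h := (T.card_le_card_shatterer.trans Finset.card_shatterer_le_sum_vcDim).trans
      (Finset.sum_le_sum_of_subset (Finset.Iic_subset_Iic.mpr hd))
    exact_mod_cast h
  have h2 : ∑ k ∈ Finset.Iic d, (n.choose k : ℝ) ≤
      (1 / x) ^ d * ∑ k ∈ Finset.Iic d, x ^ k * (n.choose k : ℝ) := by
    rw [Finset.mul_sum]
    refine Finset.sum_le_sum fun k hk => ?_
    have hk : k ≤ d := Finset.mem_Iic.mp hk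
    rw [← mul_assoc]
    refine le_mul_of_one_le_left (by positivity) ?_
    rw [one_div, inv_pow, inv_mul_eq_div, one_le_div (by positivity)]
    exact pow_le_pow_of_le_one hx.le hx1 hk
  have h3 : ∑ k ∈ Finset.Iic d, x ^ k * (n.choose k : ℝ) ≤ (x + 1) ^ n := by
    rw [add_pow]
    simp only [one_pow, mul_one]
    have : ∑ k ∈ Finset.Iic d, x ^ k * (n.choose k : ℝ) ≤
        ∑ k ∈ Finset.range (max d n + 1), x ^ k * (n.choose k : ℝ) := by
      refine Finset.sum_le_sum_of_subset_of_nonneg ?_ (fun _ _ _ => by positivity)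
      intro k hk
      simp only [Finset.mem_Iic, Finset.mem_range] at *
      omega
    refine this.trans (le_of_eq (Finset.sum_subset ?_ ?_).symm)
    · intro k hk
      simp only [Finset.mem_range] at *
      omega
    · intro k _ hk
      simp only [Finset.mem_range] at hk
      simp [Nat.choose_eq_zero_of_lt (show n < k by omega)]
  refine h1.trans (h2.trans ?_)
  gcongr
  refine h3.trans ?_
  rw [Real.exp_nat_mul]
  gcongr
  exact Real.add_one_le_exp x

open scoped symmDiff

/-- Dudley's packing bound for set families of bounded VC-dimension. -/
theorem log_card_le_of_separated {α : Type*} [Fintype α] [DecidableEq α] (T : Finset (Finset α))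
    (hT : T.Nonempty) {d : ℕ} (hd : T.vcDim ≤ d) {e : ℝ} (he : 0 < e) (he1 : e ≤ 1)
    (hn : 0 < Fintype.card α)
    (hsep : ∀ A ∈ T, ∀ B ∈ T, A ≠ B → e * Fintype.card α < (A ∆ B).card) :
    Real.log T.card ≤ 2 * d * Real.log (4 / e) + 1 / 2 := by
  set n := Fintype.card α
  have hn' : (0 : ℝ) < n := by exact_mod_cast hn
  have hN : (0 : ℝ) < T.card := by exact_mod_cast hT.card_pos
  -- With this many random points, the expected number of pairs left undistinguished is at most
  -- `|T|² (1 - e) ^ r < 1`, so some choice `g` distinguishes all members of `T`.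
  set r : ℕ := ⌊2 * Real.log T.card / e⌋₊ + 1 with hr
  have hlog : 0 ≤ Real.log T.card := Real.log_natCast_nonneg _
  have hr1 : 2 * Real.log T.card / e < r := by
    rw [hr]; push_cast; exact Nat.lt_floor_add_one _
  have hr2 : (r : ℝ) ≤ 2 * Real.log T.card / e + 1 := by
    rw [hr]; push_cast
    gcongr
    exact Nat.floor_le (by positivity)
  have hg : ∃ g : Fin r → α, ∀ A ∈ T, ∀ B ∈ T, A ≠ B → ∃ k, g k ∈ A ∆ B := by
    by_contra! hcon
    have hcover : (Finset.univ : Finset (Fin r → α)) ⊆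
        (T ×ˢ T).biUnion fun p => if p.1 = p.2 then ∅ else
          Fintype.piFinset fun _ : Fin r => (p.1 ∆ p.2)ᶜ := by
      intro g _
      obtain ⟨A, hA, B, hB, hne, hk⟩ := hcon g
      rw [Finset.mem_biUnion]
      refine ⟨(A, B), Finset.mem_product.mpr ⟨hA, hB⟩, ?_⟩
      simpa only [if_neg hne, Fintype.mem_piFinset, Finset.mem_compl] using hk
    have h1 := (Finset.card_le_card hcover).trans Finset.card_biUnion_le
    have h2 : ((n : ℝ)) ^ r ≤ ∑ p ∈ T ×ˢ T, (n * (1 - e)) ^ r := by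
      have h1' : ((Finset.univ : Finset (Fin r → α)).card : ℝ) ≤ ∑ p ∈ T ×ˢ T,
          ((if p.1 = p.2 then ∅ else Fintype.piFinset fun _ : Fin r => (p.1 ∆ p.2)ᶜ :
            Finset (Fin r → α)).card : ℝ) := by exact_mod_cast h1
      have h0 : ((Finset.univ : Finset (Fin r → α)).card : ℝ) = (n : ℝ) ^ r := by simp [n]
      rw [h0] at h1'
      refine h1'.trans (Finset.sum_le_sum fun p hp => ?_)
      have h1e : 0 ≤ 1 - e := by linarith
      split_ifs with hpe
      · simp only [Finset.card_empty, Nat.cast_zero]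
        positivity
      · have hs := hsep p.1 (Finset.mem_product.mp hp).1 p.2 (Finset.mem_product.mp hp).2 hpe
        rw [Fintype.card_piFinset_const, Nat.cast_pow, Finset.card_compl,
          Nat.cast_sub (Finset.card_le_univ _)]
        gcongr
        · exact sub_nonneg.mpr (by exact_mod_cast Finset.card_le_univ _)
        · change (n : ℝ) - _ ≤ _
          linarith
    rw [Finset.sum_const, Finset.card_product, nsmul_eq_mul, mul_pow] at h2
    have h3 : (1 : ℝ) ≤ T.card ^ 2 * (1 - e) ^ r := by
      have hp : (0 : ℝ) < (n : ℝ) ^ r := by positivity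
      push_cast at h2
      have : (n : ℝ) ^ r * 1 ≤ n ^ r * (T.card ^ 2 * (1 - e) ^ r) := by linarith
      exact le_of_mul_le_mul_left this hp
    have h4 : (1 - e) ^ r ≤ Real.exp (-(e * r)) := by
      rw [show -(e * r) = r * (-e) by ring, Real.exp_nat_mul]
      gcongr
      exact Real.one_sub_le_exp_neg e
    have h5 : (T.card : ℝ) ^ 2 = Real.exp (2 * Real.log T.card) := by
      rw [show 2 * Real.log T.card = (2 : ℕ) * Real.log T.card by norm_num, Real.exp_nat_mul,
        Real.exp_log hN]
    have h6 : (T.card : ℝ) ^ 2 * (1 - e) ^ r < 1 := by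
      calc _ ≤ Real.exp (2 * Real.log T.card) * Real.exp (-(e * r)) := by rw [h5]; gcongr
        _ = Real.exp (2 * Real.log T.card - e * r) := by rw [← Real.exp_add]; rfl
        _ < 1 := by
          rw [Real.exp_lt_one_iff]
          rw [div_lt_iff₀ he] at hr1
          linarith
    linarith
  obtain ⟨g, hg⟩ := hg
  have hcard : (comapFamily g T).card = T.card := by
    refine Finset.card_image_of_injOn fun A hA B hB hAB => ?_
    by_contra hne
    obtain ⟨k, hk⟩ := hg A hA B hB hne
    have := Finset.ext_iff.mp hAB k
    simp only [Finset.mem_filter, Finset.mem_univ, true_and] at this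
    rw [Finset.mem_symmDiff] at hk
    tauto
  -- With `x = e / 4` the exponent `r * x` is at most half of `log |T|` plus `1/4`, and that half is
  -- absorbed on the left.
  have hmain := card_le_of_vcDim_le (comapFamily g T) ((vcDim_comapFamily_le g T).trans hd)
    (x := e / 4) (by positivity) (by linarith)
  rw [hcard, Fintype.card_fin] at hmain
  have h7 := Real.log_le_log hN hmain
  rw [Real.log_mul (by positivity) (Real.exp_pos _).ne', Real.log_exp, Real.log_pow,
    one_div_div] at h7
  have h8 : (r : ℝ) * (e / 4) ≤ Real.log T.card / 2 + 1 / 4 := by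
    calc (r : ℝ) * (e / 4) ≤ (2 * Real.log T.card / e + 1) * (e / 4) := by gcongr
      _ = Real.log T.card / 2 + e / 4 := by field_simp; ring
      _ ≤ _ := by linarith
  linarith

/-- The `±1` indicator vector of a set. -/
def signVec {α : Type*} [DecidableEq α] (A : Finset α) (i : α) : ℝ := if i ∈ A then 1 else -1

theorem sum_sq_signVec_sub {α : Type*} [Fintype α] [DecidableEq α] (A B : Finset α) :
    ∑ i, (signVec A i - signVec B i) ^ 2 = 4 * (A ∆ B).card := by
  have : ∀ i, (signVec A i - signVec B i) ^ 2 = if i ∈ A ∆ B then (4 : ℝ) else 0 := by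
    intro i
    simp only [signVec, Finset.mem_symmDiff]
    by_cases hA : i ∈ A <;> by_cases hB : i ∈ B <;> simp [hA, hB] <;> norm_num
  simp [this, mul_comm]

/-- A separated subfamily of maximal cardinality covers: an uncovered set could be added to it. -/
theorem exists_separated_net {α : Type*} [Fintype α] [DecidableEq α] (T : Finset (Finset α))
    (t : ℝ) (ht : 0 ≤ t) :
    ∃ N ⊆ T, (∀ A ∈ N, ∀ B ∈ N, A ≠ B → t < (A ∆ B).card) ∧
      ∀ A ∈ T, ∃ B ∈ N, ((A ∆ B).card : ℝ) ≤ t := by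
  classical
  let P : Finset (Finset (Finset α)) := T.powerset.filter fun N =>
    ∀ A ∈ N, ∀ B ∈ N, A ≠ B → t < (A ∆ B).card
  have hP : P.Nonempty := ⟨∅, by simp [P]⟩
  obtain ⟨N, hN, hmax⟩ := P.exists_max_image Finset.card hP
  simp only [P, Finset.mem_filter, Finset.mem_powerset] at hN hmax
  refine ⟨N, hN.1, hN.2, fun A hA => ?_⟩
  by_contra! hcon
  have hAN : A ∉ N := fun h => by
    have := hcon A h
    simp only [symmDiff_self, Finset.bot_eq_empty, Finset.card_empty, Nat.cast_zero] at this
    linarith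
  have := hmax (insert A N) ⟨Finset.insert_subset hA hN.1, by
    intro B hB C hC hne
    rw [Finset.mem_insert] at hB hC
    rcases hB with rfl | hB <;> rcases hC with rfl | hC
    · exact absurd rfl hne
    · exact hcon C hC
    · rw [symmDiff_comm]; exact hcon B hB
    · exact hN.2 B hB C hC hne⟩
  rw [Finset.card_insert_of_notMem hAN] at this
  omega

theorem log_four_le : Real.log 4 ≤ 3 / 2 := by
  have : Real.log 4 = 2 * Real.log 2 := by
    rw [show (4 : ℝ) = 2 ^ 2 by norm_num, Real.log_pow]; norm_num
  linarith [Real.log_two_lt_d9]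

/-- One chaining step: passing from a net to a finer one. -/
theorem rmean_iSup_signVec_le_add {α : Type*} [Fintype α] [DecidableEq α]
    {M N : Finset (Finset α)} [Nonempty N] {t l : ℝ} (hl : 0 < l)
    (h : ∀ A ∈ N, ∃ B ∈ M, ((A ∆ B).card : ℝ) ≤ t) :
    (rmean fun σ : α → Bool => ⨆ A : N, ∑ i, sgn (σ i) * signVec A.1 i) ≤
      (rmean fun σ : α → Bool => ⨆ A : M, ∑ i, sgn (σ i) * signVec A.1 i) +
        (Real.log N.card / l + l * (4 * t) / 2) := by
  have hp : ∀ A : N, ∃ B : M, ((A.1 ∆ B.1).card : ℝ) ≤ t := fun A => by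
    obtain ⟨B, hB, h⟩ := h A.1 A.2
    exact ⟨⟨B, hB⟩, h⟩
  choose p hp using hp
  have step := rmean_iSup_le (ι := α) (fun (A : N) i => signVec A.1 i - signVec (p A).1 i)
    (K := 4 * t) hl (fun A => by
      rw [sum_sq_signVec_sub]
      gcongr
      exact hp A)
  rw [Fintype.card_coe] at step
  refine le_trans ?_ (add_le_add_right step _)
  rw [← rmean_add]
  refine rmean_mono fun σ => ciSup_le fun A => ?_
  have a1 := le_iSup_fin (fun A : M => ∑ i, sgn (σ i) * signVec A.1 i) (p A)
  have a2 := le_iSup_fin (fun A : N =>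
      ∑ i, sgn (σ i) * (signVec A.1 i - signVec (p A).1 i)) A
  refine le_trans (le_of_eq ?_) (add_le_add a1 a2)
  rw [← Finset.sum_add_distrib]
  exact Finset.sum_congr rfl fun i _ => by ring

theorem rmean_iSup_signVec_le_of_card_eq_one {α : Type*} [Fintype α] [DecidableEq α]
    {N : Finset (Finset α)} [Nonempty N] (h1 : N.card = 1) {l : ℝ} (hl : 0 < l) :
    (rmean fun σ : α → Bool => ⨆ A : N, ∑ i, sgn (σ i) * signVec A.1 i) ≤
      l * Fintype.card α / 2 := by
  have h2 := rmean_iSup_le (ι := α) (fun A : N => signVec A.1) (K := Fintype.card α) hl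
    (fun A => by
      have : ∀ i, signVec A.1 i ^ 2 = 1 := fun i => by
        unfold signVec; split_ifs <;> norm_num
      simp [this])
  rwa [Fintype.card_coe, h1, Nat.cast_one, Real.log_one, zero_div, zero_add] at h2

/-- With `l = (R / n) 2 ^ k` the entropy term is at most `R (3k + 7) / 2 ^ k` and the variance term
is `2R / 2 ^ k`. Their sum `R (3k + 9) / 2 ^ k` is exactly the increment of the closed form, which
makes the induction telescope. -/
theorem chaining_term_le {d n R L : ℝ} (hn : 0 < n) (hR : 0 < R) (hR2 : R ^ 2 = d * n) (k : ℕ)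
    (hL : L ≤ d * (3 * ((k + 1 : ℕ) : ℝ) + 4)) :
    R * (25 - (6 * k + 24) / 2 ^ k) +
        (L / (R / n * 2 ^ k) + R / n * 2 ^ k * (4 * (1 / 4 ^ k * n)) / 2) ≤
      R * (25 - (6 * ((k + 1 : ℕ) : ℝ) + 24) / 2 ^ (k + 1)) := by
  push_cast at hL ⊢
  have h3 : L / (R / n * 2 ^ k) ≤ R * (3 * k + 7) / 2 ^ k := by
    rw [div_le_div_iff₀ (by positivity) (by positivity)]
    have h8 : R * (3 * k + 7) * (R / n * 2 ^ k) = d * (3 * (k + 1) + 4) * 2 ^ k := by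
      rw [show R * (3 * k + 7) * (R / n * 2 ^ k) = R ^ 2 / n * ((3 * k + 7) * 2 ^ k) by ring,
        hR2, mul_div_assoc, div_self hn.ne']
      ring
    rw [h8]
    gcongr
  have h5 : R / n * 2 ^ k * (4 * (1 / 4 ^ k * n)) / 2 = 2 * R / 2 ^ k := by
    rw [show (4 : ℝ) ^ k = 2 ^ k * 2 ^ k by rw [← mul_pow]; norm_num]
    field_simp
    ring
  have h7 : R * (25 - (6 * k + 24) / 2 ^ k) + (R * (3 * k + 7) / 2 ^ k + 2 * R / 2 ^ k) =
      R * (25 - (6 * (k + 1) + 24) / 2 ^ (k + 1)) := by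
    rw [pow_succ]
    field_simp
    ring
  linarith

theorem log_card_net_le {α : Type*} [Fintype α] [DecidableEq α] {N : Finset (Finset α)}
    (hN : N.Nonempty) {d : ℕ} (hd0 : 0 < d) (hd : N.vcDim ≤ d) (hn : 0 < Fintype.card α) (k : ℕ)
    (hsep : ∀ A ∈ N, ∀ B ∈ N, A ≠ B → (1 / 4 ^ k : ℝ) * Fintype.card α < (A ∆ B).card) :
    Real.log N.card ≤ d * (3 * k + 4) := by
  have hd1 : (1 : ℝ) ≤ d := by exact_mod_cast hd0
  have h1 := log_card_le_of_separated N hN hd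
    (e := 1 / 4 ^ k) (by positivity) (by
      rw [div_le_one (by positivity)]; exact one_le_pow₀ (by norm_num)) hn hsep
  have h2 : Real.log (4 / (1 / 4 ^ k)) = (k + 1) * Real.log 4 := by
    rw [div_div_eq_mul_div, div_one, ← pow_succ', Real.log_pow]; push_cast; ring
  rw [h2] at h1
  have h3 : 2 * (d : ℝ) * ((k + 1) * Real.log 4) ≤ 2 * d * ((k + 1) * (3 / 2)) := by
    gcongr
    exact log_four_le
  linarith

/-- The Rademacher average of a set family of VC-dimension `d` on `n` points is `O(√(d n))`. -/
theorem rmean_iSup_signVec_le {α : Type*} [Fintype α] [DecidableEq α] (T : Finset (Finset α))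
    [Nonempty T] {d : ℕ} (hd0 : 0 < d) (hd : T.vcDim ≤ d) (hn : 0 < Fintype.card α) :
    (rmean fun σ : α → Bool => ⨆ A : T, ∑ i, sgn (σ i) * signVec A.1 i) ≤
      25 * √(d * Fintype.card α) := by
  have hn' : (0 : ℝ) < Fintype.card α := by exact_mod_cast hn
  have hd' : (0 : ℝ) < d := by exact_mod_cast hd0
  have hT : T.Nonempty := Finset.nonempty_coe_sort.mp ‹_›
  -- Hamming radius `n / 4 ^ k` means Euclidean radius `2 √n / 2 ^ k` for the sign vectors.
  choose N hNT hsep hcov using fun k : ℕ =>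
    exists_separated_net T ((1 / 4 ^ k : ℝ) * Fintype.card α) (by positivity)
  have hne : ∀ k, (N k).Nonempty := fun k => by
    obtain ⟨A, hA⟩ := hT
    obtain ⟨B, hB, -⟩ := hcov k A hA
    exact ⟨B, hB⟩
  have hne' : ∀ k, Nonempty (N k) := fun k => Finset.nonempty_coe_sort.mpr (hne k)
  have hcard : ∀ k : ℕ, Real.log (N k).card ≤ d * (3 * k + 4) := fun k =>
    log_card_net_le (hne k) hd0 ((Finset.vcDim_mono (hNT k)).trans hd) hn k (hsep k)
  have hRpos : 0 < √(d * Fintype.card α) := Real.sqrt_pos.mpr (by positivity)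
  have hR2 : √(d * Fintype.card α) ^ 2 = (d * Fintype.card α : ℝ) := Real.sq_sqrt (by positivity)
  generalize √(d * Fintype.card α) = R at hRpos hR2 ⊢
  have hW : ∀ k : ℕ, (rmean fun σ : α → Bool => ⨆ A : N k, ∑ i, sgn (σ i) * signVec A.1 i) ≤
      R * (25 - (6 * k + 24) / 2 ^ k) := by
    intro k
    induction k with
    | zero =>
      -- At scale `0` two distinct members would differ in more than `n` points.
      have h1 : (N 0).card = 1 := by
        refine le_antisymm (Finset.card_le_one.mpr fun A hA B hB => ?_) (hne 0).card_pos
        by_contra hAB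
        have h := hsep 0 A hA B hB hAB
        simp only [pow_zero, div_one, one_mul] at h
        exact absurd (Finset.card_le_univ (A ∆ B)) (not_le.mpr (by exact_mod_cast h))
      refine (rmean_iSup_signVec_le_of_card_eq_one h1
        (l := R / Fintype.card α) (by positivity)).trans ?_
      rw [div_mul_cancel₀ _ hn'.ne']
      simp only [Nat.cast_zero, pow_zero, div_one]
      linarith
    | succ k ih =>
      refine (rmean_iSup_signVec_le_add (M := N k) (l := R / Fintype.card α * 2 ^ k)
        (by positivity) fun A hA => hcov k A (hNT _ hA)).trans ?_
      exact (add_le_add_left ih _).trans (chaining_term_le hn' hRpos hR2 k (hcard (k + 1)))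
  obtain ⟨K, hK⟩ : ∃ K : ℕ, (Fintype.card α : ℝ) < 4 ^ K :=
    pow_unbounded_of_one_lt _ (by norm_num)
  -- Below distance `1` covering means equality, so the chain ends at `T` itself.
  have hall : ∀ A ∈ T, A ∈ N K := by
    intro A hA
    obtain ⟨B, hB, h⟩ := hcov K A hA
    have h1 : ((A ∆ B).card : ℝ) < 1 := h.trans_lt (by
      rw [one_div, inv_mul_eq_div, div_lt_one (by positivity)]; exact hK)
    have h2 : (A ∆ B).card = 0 := by
      have : (A ∆ B).card < 1 := by exact_mod_cast h1
      omega
    rw [Finset.card_eq_zero, ← Finset.bot_eq_empty, symmDiff_eq_bot] at h2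
    exact h2 ▸ hB
  have h1 : (rmean fun σ : α → Bool => ⨆ A : T, ∑ i, sgn (σ i) * signVec A.1 i) ≤
      rmean fun σ : α → Bool => ⨆ A : N K, ∑ i, sgn (σ i) * signVec A.1 i := by
    refine rmean_mono fun σ => ciSup_le fun A => ?_
    exact le_iSup_fin (fun A : N K => ∑ i, sgn (σ i) * signVec A.1 i) ⟨A.1, hall A.1 A.2⟩
  refine h1.trans ((hW K).trans ?_)
  rw [mul_comm]
  have h2 : (0 : ℝ) ≤ (6 * K + 24) / 2 ^ K := by positivity
  exact mul_le_mul_of_nonneg_right (by linarith) hRpos.le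

end Packing

/-! ### Traces of `H` on a sample, and passage to convex combinations. -/

section Patterns

open scoped Classical in
/-- The sets of indices labelled `1` by the hypotheses of `H` on the points `x i`. -/
noncomputable def patternFamily {X ι : Type*} [Fintype ι] (H : Set (X → ℤˣ)) (x : ι → X) :
    Finset (Finset ι) :=
  Finset.univ.filter fun A => ∃ h ∈ H, ∀ i, h (x i) = 1 ↔ i ∈ A

variable {X ι : Type*} [Fintype ι]

theorem mem_patternFamily {H : Set (X → ℤˣ)} {h : X → ℤˣ} (hh : h ∈ H) (x : ι → X) :
    (Finset.univ.filter fun i => h (x i) = 1) ∈ patternFamily H x := by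
  simp only [patternFamily, Finset.mem_filter, Finset.mem_univ, true_and]
  exact ⟨h, hh, fun _ => Iff.rfl⟩

theorem Shatters.card_le {X : Type*} {H : Set (X → ℤˣ)} {s : Finset X} (hs : Shatters H s) {d : ℕ}
    (hd : vcDim H = d) : s.card ≤ d := by
  have h : (s.card : ℕ∞) ≤ vcDim H := le_iSup₂ (f := fun (s : Finset X) (_ : Shatters H s) =>
    (s.card : ℕ∞)) s hs
  rw [hd] at h
  exact_mod_cast h

theorem units_eq_of_eq_one_iff {a b : ℤˣ} (h : a = 1 ↔ b = 1) : a = b := by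
  rcases Int.units_eq_one_or a with rfl | rfl <;> rcases Int.units_eq_one_or b with rfl | rfl
  all_goals first | rfl | (exact absurd h (by decide))

/-- Shattered indices carry distinct points, so repetitions in the sample do no harm. -/
theorem vcDim_patternFamily_le [DecidableEq ι] {H : Set (X → ℤˣ)} {d : ℕ} (hd : vcDim H = d) (x : ι → X) :
    (patternFamily H x).vcDim ≤ d := by
  classical
  refine Finset.sup_le fun s hs => ?_
  rw [Finset.mem_shatterer] at hs
  have hex : ∀ t ⊆ s, ∃ h ∈ H, ∀ i ∈ s, (h (x i) = 1 ↔ i ∈ t) := by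
    intro t ht
    obtain ⟨A, hA, hAt⟩ := hs ht
    simp only [patternFamily, Finset.mem_filter, Finset.mem_univ, true_and] at hA
    obtain ⟨h, hh, hhA⟩ := hA
    refine ⟨h, hh, fun i hi => ?_⟩
    rw [hhA, ← hAt, Finset.mem_inter]
    exact ⟨fun h => ⟨hi, h⟩, fun h => h.2⟩
  have hinj : Set.InjOn x s := by
    intro a ha b hb hab
    by_contra hne
    obtain ⟨h, -, hh⟩ := hex {a} (Finset.singleton_subset_iff.mpr ha)
    have h1 := (hh a ha).mpr (Finset.mem_singleton_self a)
    rw [hab] at h1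
    exact hne (Finset.mem_singleton.mp ((hh b hb).mp h1)).symm
  rw [← Finset.card_image_of_injOn hinj]
  refine Shatters.card_le (H := H) (fun σ => ?_) hd
  obtain ⟨h, hh, hhs⟩ := hex (s.filter fun i => σ (x i) = 1) (Finset.filter_subset _ _)
  refine ⟨h, hh, fun y hy => ?_⟩
  obtain ⟨i, hi, rfl⟩ := Finset.mem_image.mp hy
  refine units_eq_of_eq_one_iff ?_
  rw [hhs i hi, Finset.mem_filter]
  exact ⟨fun h => h.2, fun h => ⟨hi, h⟩⟩

@[simp] theorem label_one : label 1 = 1 := by simp [label]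

@[simp] theorem label_neg_one : label (-1) = -1 := by simp [label]

theorem abs_label (y : ℤˣ) : |label y| = 1 := by
  rcases Int.units_eq_one_or y with rfl | rfl <;> simp

theorem label_eq_signVec [DecidableEq ι] (h : X → ℤˣ) (x : ι → X) (i : ι) :
    label (h (x i)) = signVec (Finset.univ.filter fun i => h (x i) = 1) i := by
  simp only [signVec, Finset.mem_filter, Finset.mem_univ, true_and]
  rcases Int.units_eq_one_or (h (x i)) with h | h <;> rw [h] <;> simp

/-- A linear functional on a convex hull is bounded by its bound on the generators; hence voting
does not increase the Rademacher average. -/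
theorem sum_mul_convexCombination_le {H : Set (X → ℤˣ)} {f : X → ℝ}
    (hf : f ∈ convexCombinations H) (x : ι → X) (a : ι → ℝ) {M : ℝ}
    (hM : ∀ h ∈ H, ∑ i, a i * label (h (x i)) ≤ M) : ∑ i, a i * f (x i) ≤ M := by
  obtain ⟨t, w, h, hw, hw1, hh, hf⟩ := hf
  calc ∑ i, a i * f (x i) = ∑ k, w k * ∑ i, a i * label (h k (x i)) := by
        simp only [hf, Finset.mul_sum]
        rw [Finset.sum_comm]
        exact Finset.sum_congr rfl fun k _ => Finset.sum_congr rfl fun i _ => by ring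
    _ ≤ ∑ k, w k * M := Finset.sum_le_sum fun k _ =>
        mul_le_mul_of_nonneg_left (hM _ (hh k)) (hw k).le
    _ = M := by rw [← Finset.sum_mul, hw1, one_mul]

theorem nonempty_of_mem_convexCombinations {H : Set (X → ℤˣ)} {f : X → ℝ}
    (hf : f ∈ convexCombinations H) : H.Nonempty := by
  obtain ⟨t, w, h, -, hw1, hh, -⟩ := hf
  rcases Nat.eq_zero_or_pos t with rfl | ht
  · simp at hw1
  · exact ⟨h ⟨0, ht⟩, hh _⟩

/-- The Rademacher average of scaled convex combinations of a class of VC-dimension `d`. -/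
theorem rmean_iSup_convexCombinations_le [DecidableEq ι] {H : Set (X → ℤˣ)} {d : ℕ} (hd0 : 0 < d)
    (hd : vcDim H = d) (hn : 0 < Fintype.card ι) (x : ι → X) {J : Type*} [Finite J] [Nonempty J]
    (f : J → X → ℝ) (hf : ∀ j, f j ∈ convexCombinations H) {s : ℝ} (hs : 0 ≤ s) :
    (rmean fun σ : ι → Bool => ⨆ j, ∑ i, sgn (σ i) * (s * f j (x i))) ≤
      s * (25 * √(d * Fintype.card ι)) := by
  obtain ⟨h0, hh0⟩ := nonempty_of_mem_convexCombinations (hf (Classical.arbitrary J))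
  have : Nonempty (patternFamily H x) := ⟨⟨_, mem_patternFamily hh0 x⟩⟩
  refine le_trans ?_ (mul_le_mul_of_nonneg_left
    (rmean_iSup_signVec_le (patternFamily H x) hd0 (vcDim_patternFamily_le hd x) hn) hs)
  rw [← rmean_const_mul]
  refine rmean_mono fun σ => ciSup_le fun j => ?_
  have h1 : ∑ i, sgn (σ i) * f j (x i) ≤
      ⨆ A : patternFamily H x, ∑ i, sgn (σ i) * signVec A.1 i := by
    refine sum_mul_convexCombination_le (hf j) x (fun i => sgn (σ i)) fun h hh => ?_
    simp only [label_eq_signVec]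
    exact le_iSup_fin (fun A : patternFamily H x => ∑ i, sgn (σ i) * signVec A.1 i)
      ⟨_, mem_patternFamily hh x⟩
  refine le_trans (le_of_eq ?_) (mul_le_mul_of_nonneg_left h1 hs)
  rw [Finset.mul_sum]
  exact Finset.sum_congr rfl fun i _ => by ring

end Patterns

/-! ### Ramp loss and random swaps of a fixed double sample. -/

/-- The ramp function: `0` for `t ≤ 0`, `1` for `t ≥ γ`, linear between. -/
noncomputable def ramp (γ t : ℝ) : ℝ := max 0 (min 1 (t / γ))

theorem ramp_nonneg (γ t : ℝ) : 0 ≤ ramp γ t := le_max_left _ _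

theorem ramp_le_one (γ t : ℝ) : ramp γ t ≤ 1 := max_le zero_le_one (min_le_left _ _)

theorem ramp_of_nonpos {γ t : ℝ} (hγ : 0 < γ) (ht : t ≤ 0) : ramp γ t = 0 :=
  max_eq_left ((min_le_right _ _).trans (div_nonpos_of_nonpos_of_nonneg ht hγ.le))

theorem ramp_of_le {γ t : ℝ} (hγ : 0 < γ) (ht : γ ≤ t) : ramp γ t = 1 := by
  rw [ramp, min_eq_left ((one_le_div hγ).mpr ht)]
  exact max_eq_right zero_le_one

theorem abs_ramp_sub_le {γ : ℝ} (hγ : 0 < γ) (s t : ℝ) :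
    |ramp γ s - ramp γ t| ≤ |s - t| / γ := by
  calc |ramp γ s - ramp γ t| ≤ |min 1 (s / γ) - min 1 (t / γ)| := by
        have := abs_max_sub_max_le_max 0 (min 1 (s / γ)) 0 (min 1 (t / γ))
        simpa [ramp] using this
    _ ≤ |s / γ - t / γ| := by
        have := abs_min_sub_min_le_max 1 (s / γ) 1 (t / γ)
        simpa using this
    _ = |s - t| / γ := by rw [← sub_div, abs_div, abs_of_pos hγ]

section Swap

variable {ι : Type*}

/-- Exchange the two copies of `i` whenever `σ i` is `false`. -/
def swapFun (σ : ι → Bool) : ι ⊕ ι → ι ⊕ ι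
  | .inl i => if σ i then .inl i else .inr i
  | .inr i => if σ i then .inr i else .inl i

theorem swapFun_involutive (σ : ι → Bool) : Function.Involutive (swapFun σ) := by
  rintro (i | i) <;> by_cases h : σ i <;> simp [swapFun, h]

/-- The permutation exchanging the two copies of `i` whenever `σ i` is `false`. -/
def swapPerm (σ : ι → Bool) : Equiv.Perm (ι ⊕ ι) := (swapFun_involutive σ).toPerm

variable {X : Type*}

open scoped Classical in
/-- Double samples for which some voting classifier has margins at least `γ` on the first half and
mispredicts at least a `1 / 400` fraction of the second half. -/
def doubleBad [Fintype ι] (H : Set (X → ℤˣ)) (c : X → ℤˣ) (γ : ℝ) : Set (ι ⊕ ι → X) :=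
  {z | ∃ f ∈ convexCombinations H, (∀ i, γ ≤ label (c (z (.inl i))) * f (z (.inl i))) ∧
    (Fintype.card ι : ℝ) ≤
      400 * (Finset.univ.filter fun i => label (c (z (.inr i))) * f (z (.inr i)) ≤ 0).card}

end Swap

theorem abs_iSup_sum_update_sub_le {ι J : Type*} [Fintype ι] [DecidableEq ι] [Finite J]
    [Nonempty J] (u : J → ι → ℝ) (hu : ∀ j i, |u j i| ≤ 1) (σ : ι → Bool) (i : ι) (y : Bool) :
    |(⨆ j, ∑ l, sgn (Function.update σ i y l) * u j l) - ⨆ j, ∑ l, sgn (σ l) * u j l| ≤ 2 := by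
  have key : ∀ j, |(∑ l, sgn (Function.update σ i y l) * u j l) - ∑ l, sgn (σ l) * u j l| ≤ 2 := by
    intro j
    rw [← Finset.sum_sub_distrib, Finset.sum_eq_single i]
    · rw [Function.update_self, ← sub_mul, abs_mul]
      have h1 : |sgn y - sgn (σ i)| ≤ 2 := by
        cases y <;> cases σ i <;> norm_num [sgn]
      have := mul_le_mul h1 (hu j i) (abs_nonneg _) zero_le_two
      linarith
    · intro l _ hl
      rw [Function.update_of_ne hl, sub_self]
    · simp
  rw [abs_le]
  constructor
  · have : (⨆ j, ∑ l, sgn (σ l) * u j l) ≤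
        (⨆ j, ∑ l, sgn (Function.update σ i y l) * u j l) + 2 := ciSup_le fun j => by
      have h1 := le_iSup_fin (fun j => ∑ l, sgn (Function.update σ i y l) * u j l) j
      have h2 := abs_le.mp (key j)
      linarith [h2.1]
    linarith
  · have : (⨆ j, ∑ l, sgn (Function.update σ i y l) * u j l) ≤
        (⨆ j, ∑ l, sgn (σ l) * u j l) + 2 := ciSup_le fun j => by
      have h1 := le_iSup_fin (fun j => ∑ l, sgn (σ l) * u j l) j
      have h2 := abs_le.mp (key j)
      linarith [h2.2]
    linarith

/-- The ramp is `1/γ`-Lipschitz and labels have modulus one, so contraction strips both. The sign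
`s` lets the two halves be treated alike. -/
theorem rmean_iSup_ramp_le {X ι : Type*} [Fintype ι] [DecidableEq ι] {H : Set (X → ℤˣ)} {d : ℕ}
    (hd0 : 0 < d) (hd : vcDim H = d) (hn : 0 < Fintype.card ι) (c : X → ℤˣ) {γ : ℝ} (hγ : 0 < γ)
    (x : ι → X) {J : Type*} [Finite J] [Nonempty J]
    (f : J → X → ℝ) (hf : ∀ j, f j ∈ convexCombinations H) (s : ℝ) (hs : |s| = 1) :
    (rmean fun σ : ι → Bool =>
      ⨆ j, ∑ i, sgn (σ i) * (s * ramp γ (label (c (x i)) * f j (x i)))) ≤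
      γ⁻¹ * (25 * √(d * Fintype.card ι)) := by
  refine le_trans (rmean_iSup_contraction _ (fun j i => γ⁻¹ * f j (x i)) ?_)
    (rmean_iSup_convexCombinations_le hd0 hd hn x f hf (inv_nonneg.mpr hγ.le))
  intro i j k
  rw [← mul_sub, abs_mul, hs, one_mul, ← mul_sub, abs_mul, abs_of_pos (inv_pos.mpr hγ)]
  refine (abs_ramp_sub_le hγ _ _).trans ?_
  rw [← mul_sub, abs_mul, abs_label, one_mul, div_eq_inv_mul]

open scoped Classical in
-- The sign `σ i` undoes the swap: each term is the ramp at the training point, which is `1`, minus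
-- the ramp at the test point, which is `0` at an error and at most `1` otherwise.
theorem le_sum_sgn_mul_ramp_sub {X : Type*} {m : ℕ} {c : X → ℤˣ} {γ : ℝ} (hγ : 0 < γ)
    (z : Fin m ⊕ Fin m → X) (σ : Fin m → Bool) (f : X → ℝ)
    (h1 : ∀ i, γ ≤ label (c (z (swapPerm σ (.inl i)))) * f (z (swapPerm σ (.inl i))))
    (h2 : (m : ℝ) ≤ 400 * (Finset.univ.filter fun i =>
      label (c (z (swapPerm σ (.inr i)))) * f (z (swapPerm σ (.inr i))) ≤ 0).card) :
    (m : ℝ) / 400 ≤ ∑ i, sgn (σ i) * (ramp γ (label (c (z (.inl i))) * f (z (.inl i))) -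
      ramp γ (label (c (z (.inr i))) * f (z (.inr i)))) := by
  have h3 : (m : ℝ) / 400 ≤ ∑ i : Fin m, if label (c (z (swapPerm σ (.inr i)))) *
      f (z (swapPerm σ (.inr i))) ≤ 0 then (1 : ℝ) else 0 := by
    rw [Finset.sum_boole]
    linarith
  refine h3.trans (Finset.sum_le_sum fun i _ => ?_)
  have h4 := h1 i
  cases hσ : σ i
  · have e1 : swapPerm σ (.inl i) = .inr i := by simp [swapPerm, swapFun, hσ]
    have e2 : swapPerm σ (.inr i) = .inl i := by simp [swapPerm, swapFun, hσ]
    rw [e1] at h4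
    rw [e2, ramp_of_le hγ h4]
    split_ifs with h5
    · rw [ramp_of_nonpos hγ h5]
      norm_num [sgn]
    · have := ramp_le_one γ (label (c (z (.inl i))) * f (z (.inl i)))
      simp only [sgn, Bool.false_eq_true, if_false]
      linarith
  · have e1 : swapPerm σ (.inl i) = .inl i := by simp [swapPerm, swapFun, hσ]
    have e2 : swapPerm σ (.inr i) = .inr i := by simp [swapPerm, swapFun, hσ]
    rw [e1] at h4
    rw [e2, ramp_of_le hγ h4]
    split_ifs with h5
    · rw [ramp_of_nonpos hγ h5]
      norm_num [sgn]
    · have := ramp_le_one γ (label (c (z (.inr i))) * f (z (.inr i)))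
      simp only [sgn, if_true]
      linarith

open scoped Classical in
/-- Few random swaps of a fixed double sample are bad. -/
theorem card_swap_mem_doubleBad_le {X : Type*} {m : ℕ} (hm : 0 < m) {H : Set (X → ℤˣ)} {d : ℕ}
    (hd0 : 0 < d) (hd : vcDim H = d) (c : X → ℤˣ) {γ : ℝ} (hγ : 0 < γ)
    (hmd : 40000 ^ 2 * (d * (γ ^ 2)⁻¹) ≤ (m : ℝ)) (z : Fin m ⊕ Fin m → X) :
    ((Finset.univ.filter fun σ : Fin m → Bool =>
      (fun k => z (swapPerm σ k)) ∈ doubleBad H c γ).card : ℝ) ≤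
      2 ^ m * Real.exp (-(m / 1280000)) := by
  set B := Finset.univ.filter fun σ : Fin m → Bool =>
      (fun k => z (swapPerm σ k)) ∈ doubleBad H c γ with hB
  rcases B.eq_empty_or_nonempty with hBe | hBne
  · rw [hBe, Finset.card_empty, Nat.cast_zero]
    positivity
  have hBn : Nonempty B := Finset.nonempty_coe_sort.mpr hBne
  have hex : ∀ σ : B, (fun k => z (swapPerm σ.1 k)) ∈ doubleBad H c γ := fun σ =>
    (Finset.mem_filter.mp σ.2).2
  -- One witness per bad swap suffices, so all suprema run over the finite set `B`.
  choose f hf hf1 hf2 using hex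
  set u : B → Fin m → ℝ := fun j i => ramp γ (label (c (z (.inl i))) * f j (z (.inl i))) -
      ramp γ (label (c (z (.inr i))) * f j (z (.inr i))) with hu
  set F : (Fin m → Bool) → ℝ := fun σ => ⨆ j, ∑ i, sgn (σ i) * u j i with hF
  have hcard : 0 < Fintype.card (Fin m) := by simpa using hm
  have hlow : ∀ σ ∈ B, (m : ℝ) / 400 ≤ F σ := by
    intro σ hσ
    refine le_trans (le_sum_sgn_mul_ramp_sub hγ z σ (f ⟨σ, hσ⟩) (hf1 ⟨σ, hσ⟩) ?_)
      (le_iSup_fin (fun j => ∑ i, sgn (σ i) * u j i) ⟨σ, hσ⟩)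
    simpa using hf2 ⟨σ, hσ⟩
  -- The constant is `40000 = 25 * 1600`; the two halves together give the mean `m / 800`, half the
  -- threshold `m / 400`.
  have hsqrt : γ⁻¹ * (25 * √(d * Fintype.card (Fin m))) ≤ m / 1600 := by
    rw [Fintype.card_fin]
    have h1 : √(d * m) ≤ γ * m / 40000 := by
      rw [Real.sqrt_le_left (by positivity)]
      have h2 : 40000 ^ 2 * d ≤ (m : ℝ) * γ ^ 2 := by
        rw [← mul_assoc, ← div_eq_mul_inv, div_le_iff₀ (by positivity)] at hmd
        exact hmd
      have h3 : (40000 ^ 2 * d) * (m : ℝ) ≤ (m * γ ^ 2) * m := by gcongr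
      linarith
    calc γ⁻¹ * (25 * √(d * m)) ≤ γ⁻¹ * (25 * (γ * m / 40000)) := by gcongr
      _ = m / 1600 := by field_simp; norm_num
  have hmean : rmean F ≤ m / 800 := by
    have h1 := rmean_iSup_ramp_le hd0 hd hcard c hγ (fun i => z (.inl i)) f hf 1 (by simp)
    have h2 := rmean_iSup_ramp_le hd0 hd hcard c hγ (fun i => z (.inr i)) f hf (-1) (by simp)
    have h3 : rmean F ≤ _ := (rmean_mono (G := fun σ =>
        (⨆ j, ∑ i, sgn (σ i) * (1 * ramp γ (label (c (z (.inl i))) * f j (z (.inl i))))) +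
        ⨆ j, ∑ i, sgn (σ i) * (-1 * ramp γ (label (c (z (.inr i))) * f j (z (.inr i)))))
        fun σ => ciSup_le fun j => by
      refine le_trans (le_of_eq ?_) (add_le_add
        (le_iSup_fin (fun j => ∑ i, sgn (σ i) *
          (1 * ramp γ (label (c (z (.inl i))) * f j (z (.inl i))))) j)
        (le_iSup_fin (fun j => ∑ i, sgn (σ i) *
          (-1 * ramp γ (label (c (z (.inr i))) * f j (z (.inr i))))) j))
      rw [← Finset.sum_add_distrib]
      exact Finset.sum_congr rfl fun i _ => by simp only [hu]; ring).trans (rmean_add _ _).le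
    refine h3.trans ((add_le_add (h1.trans hsqrt) (h2.trans hsqrt)).trans (le_of_eq ?_))
    ring
  have hub : ∀ j i, |u j i| ≤ 1 := by
    intro j i
    rw [abs_le]
    constructor <;>
      linarith [ramp_nonneg γ (label (c (z (.inl i))) * f j (z (.inl i))),
        ramp_nonneg γ (label (c (z (.inr i))) * f j (z (.inr i))),
        ramp_le_one γ (label (c (z (.inl i))) * f j (z (.inl i))),
        ramp_le_one γ (label (c (z (.inr i))) * f j (z (.inr i)))]
  -- Exponential Markov with parameter `1/800`: threshold, mean and variance contribute `1/320000 -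
  -- 1/640000 - 1/1280000 = 1/1280000` per sample point.
  have hexp := rmean_exp_le m (fun σ => 1 / 800 * F σ) (1 / 800) (fun σ i y => by
    rw [← mul_sub, abs_mul, abs_of_pos (by norm_num : (0 : ℝ) < 1 / 800)]
    linarith [abs_iSup_sum_update_sub_le u hub σ i y])
  rw [rmean_const_mul] at hexp
  have hcount : (B.card : ℝ) * Real.exp (1 / 800 * (m / 400)) ≤
      2 ^ m * rmean fun σ => Real.exp (1 / 800 * F σ) := by
    rw [rmean, Fintype.card_fin, mul_div_cancel₀ _ (by positivity), ← nsmul_eq_mul,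
      ← Finset.sum_const]
    refine (Finset.sum_le_sum fun σ hσ => Real.exp_le_exp.mpr
      (mul_le_mul_of_nonneg_left (hlow σ hσ) (by norm_num))).trans
      (Finset.sum_le_sum_of_subset_of_nonneg (Finset.subset_univ _)
        fun _ _ _ => (Real.exp_pos _).le)
  have h4 : (B.card : ℝ) * Real.exp (1 / 800 * (m / 400)) ≤
      2 ^ m * Real.exp (-(m / 1280000)) * Real.exp (1 / 800 * (m / 400)) := by
    refine hcount.trans ?_
    rw [mul_assoc, ← Real.exp_add]
    gcongr
    refine hexp.trans (Real.exp_le_exp.mpr ?_)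
    linarith
  exact le_of_mul_le_mul_right h4 (Real.exp_pos _)

/-! ### Measurability of the double-sample event. -/

open scoped ENNReal

theorem measurable_label : Measurable label :=
  (measurable_from_top (f := fun n : ℤ => (n : ℝ))).comp (comap_measurable Units.val)

theorem measurableSet_units_singleton (u : ℤˣ) : MeasurableSet {u} := by
  refine ⟨{(u : ℤ)}, trivial, ?_⟩
  ext y
  simp [Units.ext_iff]

variable {X : Type*} [MeasurableSpace X]

theorem measurePreserving_comp_equiv {ι ι' : Type*} [Fintype ι] [Fintype ι'] (D : Measure X)
    [IsProbabilityMeasure D] (e : ι ≃ ι') :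
    MeasurePreserving (fun (z : ι' → X) i => z (e i)) (Measure.pi fun _ => D)
      (Measure.pi fun _ => D) := by
  have h := measurePreserving_piCongrLeft (α := fun _ : ι => X) (fun _ : ι => D) e.symm
  convert h using 1
  ext z i
  rw [MeasurableEquiv.coe_piCongrLeft]
  have := Equiv.piCongrLeft_apply_apply (P := fun _ : ι => X) e.symm z (e i)
  rw [Equiv.symm_apply_apply] at this
  exact this.symm

/-- The labellings of the points `z i` realized by `H`. -/
def patterns {X ι : Type*} (H : Set (X → ℤˣ)) (z : ι → X) : Set (ι → ℤˣ) :=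
  {v | ∃ h ∈ H, ∀ i, h (z i) = v i}

theorem MeasurableClass.nullMeasurableSet_mem_patterns {D : Measure X} [IsProbabilityMeasure D]
    {H : Set (X → ℤˣ)} (hH : MeasurableClass D H) {ι : Type*} [Fintype ι] (v : ι → ℤˣ) :
    NullMeasurableSet {z : ι → X | v ∈ patterns H z} (Measure.pi fun _ => D) := by
  have e := Fintype.equivFin ι
  have h := (hH.pattern (Fintype.card ι) fun k => v (e.symm k)).preimage
    (measurePreserving_comp_equiv D e.symm).quasiMeasurePreserving
  convert h using 1
  ext z
  simp only [patterns, Set.mem_ofPred_eq, Set.mem_preimage]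
  refine exists_congr fun h => and_congr_right fun _ => ?_
  exact e.symm.forall_congr_right.symm

/-- The realized patterns and the labels take finitely many values, so the event is a finite union
of intersections of pattern events, their complements and label events. -/
theorem MeasurableClass.nullMeasurableSet_of_patterns {D : Measure X} [IsProbabilityMeasure D]
    {H : Set (X → ℤˣ)} (hH : MeasurableClass D H) {c : X → ℤˣ} (hc : Measurable c)
    {ι : Type*} [Fintype ι] (Q : Set (ι → ℤˣ) → (ι → ℤˣ) → Prop) :
    NullMeasurableSet {z : ι → X | Q (patterns H z) fun i => c (z i)} (Measure.pi fun _ => D) := by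
  have hset : {z : ι → X | Q (patterns H z) fun i => c (z i)} =
      ⋃ p ∈ {p : Set (ι → ℤˣ) × (ι → ℤˣ) | Q p.1 p.2},
        ((⋂ v : ι → ℤˣ, {z : ι → X | v ∈ patterns H z ↔ v ∈ p.1}) ∩
          ⋂ i, {z : ι → X | c (z i) = p.2 i}) := by
    ext z
    simp only [Set.mem_ofPred_eq, Set.mem_iUnion, Set.mem_inter_iff, Set.mem_iInter, exists_prop,
      Prod.exists]
    constructor
    · intro h
      exact ⟨_, _, h, fun _ => Iff.rfl, fun _ => rfl⟩
    · rintro ⟨W, u, h, hW, hu⟩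
      rwa [show patterns H z = W from Set.ext hW, show (fun i => c (z i)) = u from funext hu]
  rw [hset]
  refine NullMeasurableSet.biUnion (Set.to_countable _) fun p _ => ?_
  refine NullMeasurableSet.inter (NullMeasurableSet.iInter fun v => ?_)
    (MeasurableSet.iInter fun i => ?_).nullMeasurableSet
  · by_cases hv : v ∈ p.1
    · simpa only [hv, iff_true] using hH.nullMeasurableSet_mem_patterns v
    · simp only [hv, iff_false]
      exact (hH.nullMeasurableSet_mem_patterns v).compl
  · exact (hc.comp (measurable_pi_apply i)) (measurableSet_units_singleton (p.2 i))

/-- Keep the weights and replace each hypothesis by one giving the same labels on `z'`. -/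
theorem mem_doubleBad_of_patterns_eq {X ι : Type*} [Fintype ι] {H : Set (X → ℤˣ)} {c : X → ℤˣ}
    {γ : ℝ} {z z' : ι ⊕ ι → X} (hp : patterns H z = patterns H z')
    (hc : ∀ i, c (z i) = c (z' i)) (hz : z ∈ doubleBad H c γ) : z' ∈ doubleBad H c γ := by
  obtain ⟨f, ⟨t, w, h, hw, hw1, hh, hf⟩, h1, h2⟩ := hz
  have hex : ∀ k, ∃ h' ∈ H, ∀ i, h' (z' i) = h k (z i) := fun k => by
    have : (fun i => h k (z i)) ∈ patterns H z' := hp ▸ ⟨h k, hh k, fun _ => rfl⟩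
    exact this
  choose h' hh' hhz using hex
  have hff : ∀ i, ∑ k, w k * label (h' k (z' i)) = f (z i) := fun i => by
    simp only [hf, hhz]
  refine ⟨fun x => ∑ k, w k * label (h' k x), ⟨t, w, h', hw, hw1, hh', fun _ => rfl⟩, ?_, ?_⟩
  · intro i
    simpa only [hff, ← hc] using h1 i
  · simpa only [hff, ← hc] using h2

theorem nullMeasurableSet_doubleBad {D : Measure X} [IsProbabilityMeasure D]
    {H : Set (X → ℤˣ)} (hH : MeasurableClass D H) {c : X → ℤˣ} (hc : Measurable c)
    {ι : Type*} [Fintype ι] (γ : ℝ) :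
    NullMeasurableSet (doubleBad H c γ : Set (ι ⊕ ι → X)) (Measure.pi fun _ => D) := by
  have h := hH.nullMeasurableSet_of_patterns (ι := ι ⊕ ι) hc fun W u =>
    ∃ z ∈ doubleBad H c γ, patterns H z = W ∧ ∀ i, c (z i) = u i
  convert h using 1
  ext z
  exact ⟨fun hz => ⟨z, hz, rfl, fun _ => rfl⟩,
    fun ⟨_, hz, hp, hc⟩ => mem_doubleBad_of_patterns_eq hp hc hz⟩

/-! ### Symmetrization and transfer to a single sample. -/

open scoped Classical in
/-- Symmetrization by random swaps. -/
theorem measure_doubleBad_le {D : Measure X} [IsProbabilityMeasure D] {m : ℕ} (hm : 0 < m)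
    {H : Set (X → ℤˣ)} (hH : MeasurableClass D H) {c : X → ℤˣ} (hc : Measurable c) {d : ℕ}
    (hd0 : 0 < d) (hd : vcDim H = d) {γ : ℝ} (hγ : 0 < γ)
    (hmd : 40000 ^ 2 * (d * (γ ^ 2)⁻¹) ≤ (m : ℝ)) :
    (Measure.pi fun _ : Fin m ⊕ Fin m => D) (doubleBad H c γ) ≤
      ENNReal.ofReal (Real.exp (-(m / 1280000))) := by
  set Q := Measure.pi fun _ : Fin m ⊕ Fin m => D
  set A : Set (Fin m ⊕ Fin m → X) := doubleBad H c γ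
  have hA : NullMeasurableSet A Q := nullMeasurableSet_doubleBad hH hc γ
  have hpre : ∀ σ : Fin m → Bool, MeasurePreserving
      (fun (z : Fin m ⊕ Fin m → X) k => z (swapPerm σ k)) Q Q :=
    fun σ => measurePreserving_comp_equiv D (swapPerm σ)
  set Aσ : (Fin m → Bool) → Set (Fin m ⊕ Fin m → X) := fun σ =>
    (fun (z : Fin m ⊕ Fin m → X) k => z (swapPerm σ k)) ⁻¹' A with hAσ
  have hAσ_null : ∀ σ, NullMeasurableSet (Aσ σ) Q := fun σ =>
    hA.preimage (hpre σ).quasiMeasurePreserving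
  -- Each swap preserves `Q`, so averaging over swaps leaves the probability unchanged and a bound
  -- pointwise in `z` suffices.
  have hsum : (2 : ℝ≥0∞) ^ m * Q A = ∫⁻ z, ∑ σ, (Aσ σ).indicator (fun _ => (1 : ℝ≥0∞)) z ∂Q := by
    rw [lintegral_finsetSum' _ fun σ _ =>
      (aemeasurable_indicator_const_iff (1 : ℝ≥0∞)).mpr (hAσ_null σ)]
    have : ∀ σ, ∫⁻ z, (Aσ σ).indicator (fun _ => (1 : ℝ≥0∞)) z ∂Q = Q A := fun σ => by
      rw [lintegral_indicator_const₀ (hAσ_null σ), one_mul]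
      exact (hpre σ).measure_preimage hA
    simp [this]
  have hbound : ∀ z, ∑ σ, (Aσ σ).indicator (fun _ => (1 : ℝ≥0∞)) z ≤
      ENNReal.ofReal (2 ^ m * Real.exp (-(m / 1280000))) := by
    intro z
    have h1 : ∑ σ, (Aσ σ).indicator (fun _ => (1 : ℝ≥0∞)) z = ((Finset.univ.filter fun σ : Fin m → Bool =>
        (fun k => z (swapPerm σ k)) ∈ A).card : ℝ≥0∞) := by
      rw [← Finset.sum_boole]
      rfl
    rw [h1, ← ENNReal.ofReal_natCast]
    exact ENNReal.ofReal_le_ofReal (card_swap_mem_doubleBad_le hm hd0 hd c hγ hmd z)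
  have h2 : (2 : ℝ≥0∞) ^ m * Q A ≤ 2 ^ m * ENNReal.ofReal (Real.exp (-(m / 1280000))) := by
    rw [hsum]
    refine (lintegral_mono hbound).trans (le_of_eq ?_)
    rw [lintegral_const, measure_univ, mul_one, ENNReal.ofReal_mul (by positivity),
      ENNReal.ofReal_pow zero_le_two, ENNReal.ofReal_ofNat]
  exact (ENNReal.mul_le_mul_iff_right (by positivity) (by finiteness)).mp h2

open scoped Classical in
/-- A lower tail bound for the number of sample points in a set of probability at least `1/200`. -/
theorem half_le_measure_count (D : Measure X) [IsProbabilityMeasure D] {m : ℕ} (hm : 2000 ≤ m)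
    {e : Set X} (he : MeasurableSet e) (hp : 1 / 200 ≤ D.real e) :
    (1 / 2 : ℝ≥0∞) ≤ sampleLaw D m
      {S | (m : ℝ) ≤ 400 * (Finset.univ.filter fun i => S i ∈ e).card} := by
  have hprob : IsProbabilityMeasure (sampleLaw D m) := by unfold sampleLaw; infer_instance
  set G : Set (Fin m → X) := {S | (m : ℝ) ≤ 400 * (Finset.univ.filter fun i => S i ∈ e).card}
  -- This is `exp (-1)` on `e` and `1` elsewhere: a Chernoff bound for the lower tail of the count.
  set g : X → ℝ := fun x => 1 - e.indicator (fun _ => 1 - Real.exp (-1)) x with hg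
  have hgint : Integrable g D := (integrable_const 1).sub ((integrable_const _).indicator he)
  have hg0 : ∀ x, 0 ≤ g x := fun x => by
    by_cases hx : x ∈ e
    · simp [hg, hx, (Real.exp_pos (-1)).le]
    · simp [hg, hx]
  have hgI : ∫ x, g x ∂D ≤ Real.exp (-(3 / 1000)) := by
    rw [integral_sub (integrable_const _) ((integrable_const _).indicator he),
      integral_indicator_const _ he]
    simp only [integral_const, probReal_univ, smul_eq_mul, one_mul]
    have h1 := Real.one_sub_le_exp_neg (3 / 1000)
    have h2 : 1 / 200 * (3 / 5) ≤ D.real e * (1 - Real.exp (-1)) := by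
      gcongr
      linarith [Real.exp_neg_one_lt_d9]
    linarith
  have hprod : ∀ S : Fin m → X, ∏ i, g (S i) =
      Real.exp (-((Finset.univ.filter fun i => S i ∈ e).card : ℝ)) := by
    intro S
    have h1 : ∀ i, g (S i) = Real.exp (if S i ∈ e then -1 else 0) := fun i => by
      by_cases hx : S i ∈ e
      · simp [hg, hx]
      · simp [hg, hx]
    simp only [h1, ← Real.exp_sum]
    congr 1
    rw [Finset.sum_ite]
    simp
  have hint : Integrable (fun S : Fin m → X => ∏ i, g (S i)) (sampleLaw D m) :=
    Integrable.fintype_prod fun _ => hgint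
  have hmark := mul_meas_ge_le_integral_of_nonneg (μ := sampleLaw D m)
    (ae_of_all _ fun S => Finset.prod_nonneg fun i _ => hg0 (S i)) hint (Real.exp (-(m / 400)))
  have hI : ∫ S, ∏ i, g (S i) ∂(sampleLaw D m) ≤ Real.exp (m * -(3 / 1000)) := by
    rw [sampleLaw, integral_fintype_prod_eq_pow, Fintype.card_fin, Real.exp_nat_mul]
    exact pow_le_pow_left₀ (integral_nonneg hg0) hgI m
  have hsub : Gᶜ ⊆ {S : Fin m → X | Real.exp (-(m / 400)) ≤ ∏ i, g (S i)} := by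
    intro S hS
    simp only [G, Set.mem_compl_iff, Set.mem_ofPred_eq, not_le] at hS
    rw [Set.mem_ofPred_eq, hprod]
    exact Real.exp_le_exp.mpr (by linarith)
  have hcompl : (sampleLaw D m).real Gᶜ ≤ 1 / 2 := by
    refine (measureReal_mono hsub).trans ?_
    have hm' : (2000 : ℝ) ≤ m := by exact_mod_cast hm
    -- The gap `3/1000 - 1/400 = 1/2000` is why `m ≥ 2000` is needed.
    have h1 : Real.exp (m * -(3 / 1000)) ≤ Real.exp (-(m / 400)) * Real.exp (-1) := by
      rw [← Real.exp_add]
      exact Real.exp_le_exp.mpr (by linarith)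
    have h2 := le_of_mul_le_mul_left (hmark.trans (hI.trans h1)) (Real.exp_pos _)
    linarith [Real.exp_neg_one_lt_d9]
  have h1 : (1 : ℝ) ≤ (sampleLaw D m).real G + (sampleLaw D m).real Gᶜ := by
    rw [← probReal_univ (μ := sampleLaw D m), ← Set.union_compl_self G]
    exact measureReal_union_le _ _
  have h2 : 1 / 2 ≤ (sampleLaw D m).real G := by linarith
  have h3 : (1 / 2 : ℝ≥0∞) = ENNReal.ofReal (1 / 2) := by
    rw [ENNReal.ofReal_div_of_pos zero_lt_two]; simp
  rw [h3]
  exact ENNReal.ofReal_le_of_le_toReal h2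

theorem MeasurableClass.measurable_convexCombination {D : Measure X} {H : Set (X → ℤˣ)}
    (hH : MeasurableClass D H) {f : X → ℝ} (hf : f ∈ convexCombinations H) : Measurable f := by
  obtain ⟨t, w, h, -, -, hh, hf⟩ := hf
  rw [show f = _ from funext hf]
  exact Finset.measurable_sum _ fun k _ =>
    (measurable_label.comp (hH.measurable _ (hh k))).const_mul _

theorem votingClassifier_ne_label_iff {X : Type*} (f : X → ℝ) (x : X) (y : ℤˣ) :
    votingClassifier f x ≠ label y ↔ label y * f x ≤ 0 := by
  unfold votingClassifier
  rcases lt_trichotomy (f x) 0 with h | h | h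
  · rw [Real.sign_of_neg h]
    rcases Int.units_eq_one_or y with rfl | rfl
    · norm_num [h.le]
    · simp [h]
  · rw [h, Real.sign_zero]
    rcases Int.units_eq_one_or y with rfl | rfl <;> simp
  · rw [Real.sign_of_pos h]
    rcases Int.units_eq_one_or y with rfl | rfl
    · simp [h]
    · norm_num [h.le]

open scoped Classical in
/-- The double sample bound transferred to a single sample. -/
theorem exists_good_event {D : Measure X} [IsProbabilityMeasure D] {m : ℕ} (hm : 2000 ≤ m)
    {H : Set (X → ℤˣ)} (hH : MeasurableClass D H) {c : X → ℤˣ} (hc : Measurable c) {γ : ℝ} {q : ℝ}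
    (hq0 : 0 ≤ q)
    (hq : (Measure.pi fun _ : Fin m ⊕ Fin m => D) (doubleBad H c γ) ≤ ENNReal.ofReal q) :
    ∃ E : Set (Fin m → X), MeasurableSet E ∧ 1 - 2 * q ≤ (sampleLaw D m).real E ∧
      ∀ S ∈ E, ∀ f ∈ convexCombinations H, (∀ i, γ ≤ label (c (S i)) * f (S i)) →
        generalizationError D c (votingClassifier f) ≤ 1 / 200 := by
  have hprob : IsProbabilityMeasure (sampleLaw D m) := by unfold sampleLaw; infer_instance
  set Q := Measure.pi fun _ : Fin m ⊕ Fin m => D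
  -- The event is replaced by a measurable superset of equal measure so that its sections can be
  -- integrated.
  set A := toMeasurable Q (doubleBad H c γ)
  have hA : MeasurableSet A := measurableSet_toMeasurable _ _
  set φ : (Fin m → X) × (Fin m → X) → (Fin m ⊕ Fin m → X) :=
    ⇑(MeasurableEquiv.sumPiEquivProdPi fun _ : Fin m ⊕ Fin m => X).symm
  have hφ : MeasurePreserving φ ((sampleLaw D m).prod (sampleLaw D m)) Q :=
    measurePreserving_sumPiEquivProdPi_symm fun _ : Fin m ⊕ Fin m => D
  have hφA : MeasurableSet (φ ⁻¹' A) := hφ.measurable hA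
  set G : (Fin m → X) → ℝ≥0∞ := fun S => sampleLaw D m (Prod.mk S ⁻¹' (φ ⁻¹' A))
  have hG : Measurable G := measurable_measure_prodMk_left hφA
  -- Markov at level `1/2`: the good samples are those whose section of `A` has probability below
  -- `1/2`, and the others have total mass at most `2 * q`.
  have hmark := mul_meas_ge_le_lintegral (μ := sampleLaw D m) hG (1 / 2)
  have hint : ∫⁻ S, G S ∂(sampleLaw D m) ≤ ENNReal.ofReal q := by
    rw [← Measure.prod_apply hφA, hφ.measure_preimage hA.nullMeasurableSet, measure_toMeasurable]
    exact hq
  have hBm : MeasurableSet {S | 1 / 2 ≤ G S} := measurableSet_le measurable_const hG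
  refine ⟨{S | 1 / 2 ≤ G S}ᶜ, hBm.compl, ?_, ?_⟩
  · rw [probReal_compl_eq_one_sub hBm]
    have h1 := ENNReal.toReal_mono ENNReal.ofReal_ne_top (hmark.trans hint)
    rw [ENNReal.toReal_mul, ENNReal.toReal_ofReal hq0] at h1
    have h2 : (1 / 2 : ℝ≥0∞).toReal = 1 / 2 := by simp
    rw [h2] at h1
    change 1 / 2 * (sampleLaw D m).real {S | 1 / 2 ≤ G S} ≤ q at h1
    linarith
  · intro S hS f hf hmargin
    by_contra! hcon
    refine hS ?_
    rw [Set.mem_ofPred_eq]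
    have hset : {x | votingClassifier f x ≠ label (c x)} = {x | label (c x) * f x ≤ 0} := by
      ext x
      exact votingClassifier_ne_label_iff f x (c x)
    have he : MeasurableSet {x | label (c x) * f x ≤ 0} := measurableSet_le
      ((measurable_label.comp hc).mul (hH.measurable_convexCombination hf)) measurable_const
    rw [generalizationError, hset] at hcon
    refine (half_le_measure_count D hm he hcon.le).trans (measure_mono fun S' hS' => ?_)
    refine subset_toMeasurable _ _ ⟨f, hf, hmargin, ?_⟩
    rw [Fintype.card_fin]
    exact hS'

/-! ### The degenerate cases. -/

/-- Two hypotheses that differ at `x` would shatter `{x}`. -/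
theorem eq_of_vcDim_eq_zero {X : Type*} {H : Set (X → ℤˣ)} (hd : vcDim H = 0) {g h : X → ℤˣ}
    (hg : g ∈ H) (hh : h ∈ H) : g = h := by
  funext x
  by_contra hne
  have hs : Shatters H {x} := by
    intro σ
    simp only [Finset.mem_singleton, forall_eq]
    by_cases hx : g x = σ x
    · exact ⟨g, hg, hx⟩
    · refine ⟨h, hh, ?_⟩
      rcases Int.units_eq_one_or (g x) with h1 | h1 <;>
        rcases Int.units_eq_one_or (h x) with h2 | h2 <;>
        rcases Int.units_eq_one_or (σ x) with h3 | h3 <;> simp_all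
  have := hs.card_le (d := 0) (by simpa using hd)
  simp at this

theorem abs_convexCombination_le_one {X : Type*} {H : Set (X → ℤˣ)} {f : X → ℝ}
    (hf : f ∈ convexCombinations H) (x : X) : |f x| ≤ 1 := by
  obtain ⟨t, w, h, hw, hw1, -, hf⟩ := hf
  rw [hf]
  refine (Finset.abs_sum_le_sum_abs _ _).trans (le_of_eq ?_)
  simp only [abs_mul, abs_label, mul_one]
  rw [← hw1]
  exact Finset.sum_congr rfl fun k _ => abs_of_pos (hw k)

theorem convexCombination_eq_label {X : Type*} {H : Set (X → ℤˣ)} {f : X → ℝ} {h : X → ℤˣ}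
    (hf : f ∈ convexCombinations H) (hH : ∀ g ∈ H, g = h) : f = fun x => label (h x) := by
  obtain ⟨t, w, h', -, hw1, hh, hf⟩ := hf
  funext x
  rw [hf]
  simp only [hH _ (hh _), ← Finset.sum_mul, hw1, one_mul]

/-- A single hypothesis with error above `1 / 200` is unlikely to be consistent. -/
theorem exists_good_event_of_vcDim_eq_zero {X : Type*} [MeasurableSpace X] (D : Measure X)
    [IsProbabilityMeasure D] {H : Set (X → ℤˣ)} (hH : MeasurableClass D H) (hd : vcDim H = 0)
    {c : X → ℤˣ} (hc : Measurable c) {γ : ℝ} (hγ : 0 < γ) (m : ℕ) :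
    ∃ E : Set (Fin m → X), MeasurableSet E ∧
      1 - Real.exp (-(m / 200)) ≤ (sampleLaw D m).real E ∧
      ∀ S ∈ E, ∀ f ∈ convexCombinations H, (∀ i, γ ≤ label (c (S i)) * f (S i)) →
        generalizationError D c (votingClassifier f) ≤ 1 / 200 := by
  have hprob : IsProbabilityMeasure (sampleLaw D m) := by unfold sampleLaw; infer_instance
  by_cases hbad : ∃ f ∈ convexCombinations H,
      1 / 200 < generalizationError D c (votingClassifier f)
  · obtain ⟨f, hf, hfe⟩ := hbad
    obtain ⟨h, hh⟩ := nonempty_of_mem_convexCombinations hf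
    have huniq : ∀ g ∈ H, g = h := fun g hg => eq_of_vcDim_eq_zero hd hg hh
    obtain rfl := convexCombination_eq_label hf huniq
    set e : Set X := {x | votingClassifier (fun x => label (h x)) x ≠ label (c x)} with he
    have hem : MeasurableSet e := by
      have : e = {x | label (c x) * label (h x) ≤ 0} := by
        ext x
        exact votingClassifier_ne_label_iff _ x (c x)
      rw [this]
      exact measurableSet_le ((measurable_label.comp hc).mul
        (measurable_label.comp (hH.measurable h hh))) measurable_const
    have hEm : MeasurableSet (Set.univ.pi fun _ : Fin m => eᶜ) :=
      MeasurableSet.univ_pi fun _ => hem.compl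
    refine ⟨(Set.univ.pi fun _ : Fin m => eᶜ)ᶜ, hEm.compl, ?_, ?_⟩
    · rw [probReal_compl_eq_one_sub hEm]
      have h1 : (sampleLaw D m).real (Set.univ.pi fun _ : Fin m => eᶜ) = (1 - D.real e) ^ m := by
        rw [← probReal_compl_eq_one_sub hem, measureReal_def, sampleLaw, Measure.pi_pi]
        simp [measureReal_def]
      have h2 : (1 - D.real e) ^ m ≤ Real.exp (-(m / 200)) := by
        rw [show -((m : ℝ) / 200) = m * -(1 / 200) by ring, Real.exp_nat_mul]
        refine pow_le_pow_left₀ (sub_nonneg.mpr measureReal_le_one) ?_ m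
        have h3 := Real.one_sub_le_exp_neg (1 / 200)
        change 1 / 200 < D.real e at hfe
        linarith
      linarith
    · intro S hS f' hf' hmargin
      refine absurd (Set.mem_univ_pi.mpr fun i => ?_) hS
      obtain rfl := convexCombination_eq_label hf' huniq
      have h4 := hmargin i
      rw [he, Set.mem_compl_iff, Set.mem_ofPred_eq, votingClassifier_ne_label_iff]
      exact not_le.mpr (hγ.trans_le h4)
  · push Not at hbad
    refine ⟨Set.univ, MeasurableSet.univ, ?_, fun S _ f hf _ => hbad f hf⟩
    rw [probReal_univ]
    linarith [Real.exp_pos (-((m : ℝ) / 200))]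

end Voting

/-! ### Assembly and choice of the constant. -/

theorem mainTheorem2 :
    ∃ α : ℝ, 0 < α ∧
      ∀ (X : Type*) [MeasurableSpace X] (D : MeasureTheory.Measure X)
        [MeasureTheory.IsProbabilityMeasure D]
        (c : X → ℤˣ) (_ : Measurable c)
        (H : Set (X → ℤˣ)) (_ : Voting.MeasurableClass D H)
        (d : ℕ) (_ : Voting.vcDim H = d)
        (γ : ℝ) (_ : 0 < γ) (δ : ℝ) (_ : 0 < δ) (_ : δ < 1)
        (m : ℕ) (_ : α * (d * (γ ^ 2)⁻¹ + Real.log (1 / δ)) ≤ m),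
        ∃ E : Set (Fin m → X), MeasurableSet E ∧ 1 - δ ≤ (Voting.sampleLaw D m).real E ∧
          ∀ S ∈ E, ∀ f ∈ Voting.convexCombinations H,
            (∀ i, γ ≤ Voting.label (c (S i)) * f (S i)) →
              Voting.generalizationError D c (Voting.votingClassifier f) ≤ 1 / 200 := by
  refine ⟨40000 ^ 2, by norm_num, ?_⟩
  intro X _ D _ c hc H hH d hd γ hγ δ hδ hδ1 m hm
  have hlog : 0 < Real.log (1 / δ) := Real.log_pos (by rw [lt_div_iff₀ hδ]; linarith)
  have hlogδ : Real.log (1 / δ) = -Real.log δ := by rw [one_div, Real.log_inv]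
  have hdγ : (0 : ℝ) ≤ d * (γ ^ 2)⁻¹ := by positivity
  have hexp : ∀ {t : ℝ}, t ≤ Real.log δ → Real.exp t ≤ δ := fun ht => by
    rwa [← Real.le_log_iff_exp_le hδ]
  rcases Nat.eq_zero_or_pos d with rfl | hd0
  · obtain ⟨E, hE, hE1, hE2⟩ :=
      Voting.exists_good_event_of_vcDim_eq_zero D hH (by simpa using hd) hc hγ m
    refine ⟨E, hE, le_trans ?_ hE1, hE2⟩
    have := hexp (t := -((m : ℝ) / 200)) (by linarith)
    linarith
  have hm0 : 0 < m := by
    have : (0 : ℝ) < m := by linarith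
    exact_mod_cast this
  -- Convex combinations are bounded by `1`, so for `γ > 1` no margin condition can hold; for `γ ≤
  -- 1` one has `d / γ² ≥ 1`, which makes `m` large.
  rcases lt_or_ge 1 γ with hγ1 | hγ1
  · have hprob : IsProbabilityMeasure (Voting.sampleLaw D m) := by
      unfold Voting.sampleLaw; infer_instance
    refine ⟨Set.univ, MeasurableSet.univ, by rw [probReal_univ]; linarith, ?_⟩
    intro S _ f hf hmargin
    have h1 := (hmargin ⟨0, hm0⟩).trans (le_abs_self _)
    rw [abs_mul, Voting.abs_label, one_mul] at h1
    linarith [Voting.abs_convexCombination_le_one hf (S ⟨0, hm0⟩)]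
  · have h1 : (1 : ℝ) ≤ d * (γ ^ 2)⁻¹ :=
      one_le_mul_of_one_le_of_one_le (by exact_mod_cast hd0)
        ((one_le_inv₀ (by positivity)).mpr (pow_le_one₀ hγ.le hγ1))
    have hm2 : 2000 ≤ m := by
      have : (2000 : ℝ) ≤ m := by linarith
      exact_mod_cast this
    obtain ⟨E, hE, hE1, hE2⟩ := Voting.exists_good_event hm2 hH hc (Real.exp_pos _).le
      (Voting.measure_doubleBad_le hm0 hH hc hd0 hd hγ (by linarith))
    refine ⟨E, hE, le_trans ?_ hE1, hE2⟩
    -- The Markov factor `2 ≤ e` is absorbed because `m / 1280000 ≥ 1 + log (1 / δ)`.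
    have h2 : 2 * Real.exp (-((m : ℝ) / 1280000)) ≤ δ := by
      have h3 : (2 : ℝ) ≤ Real.exp 1 := by linarith [Real.add_one_le_exp (1 : ℝ)]
      calc 2 * Real.exp (-((m : ℝ) / 1280000)) ≤
            Real.exp 1 * Real.exp (-((m : ℝ) / 1280000)) := by gcongr
        _ = Real.exp (1 + -((m : ℝ) / 1280000)) := by rw [← Real.exp_add]
        _ ≤ δ := hexp (by linarith)
    linarith
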